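/- Let $D$ be a finite nonempty digraph without loops and without digons (directed cycles of length $2$). A missing edge of $D$ is a pair $xy$ of distinct vertices with neither $(x,y)$ nor $(y,x)$ an arc of $D$; the missing graph of $D$ is the graph whose edges are the missing edges of $D$ and whose vertices are the endpoints of these edges. For a vertex $v$, let $N^+(v)$ be the set of out-neighbors of $v$, let $N^{++}(v)$ be the set of vertices at distance exactly $2$ from $v$, and let $d^+(v)=|N^+(v)|$, $d^{++}(v)=|N^{++}(v)|$. A missing edge $x_1y_1$ loses to a missing edge $x_2y_2$ if, for a suitable labelling of the two endpoints of each edge, $x_1\to x_2$, $y_2\notin N^+(x_1)\cup N^{++}(x_1)$, $y_1\to y_2$ and $x_2\notin N^+(y_1)\cup N^{++}(y_1)$. The dependency digraph $\Delta$ of $D$ has the missing edges of $D$ as vertices and an arc from $e$ to $f$ whenever $e$ loses to $f$; its connected components are those of its underlying undirected graph. Suppose that the missing graph of $D$ is the vertex-disjoint union of one star (a graph, possibly without edges, all of whose edges share one vertex) and a matching (a possibly empty set of pairwise disjoint edges). Suppose also that every connected component of $\Delta$ that contains an edge of the star has positive minimum out-degree and positive minimum in-degree. Then $D$ has a vertex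 $v$ with $d^+(v)\le d^{++}(v)$. -/

import Mathlib

namespace Digraph

/-- A digraph without directed cycles of length 1 or 2 (no loops, no digons). -/
def IsOriented {V : Type*} (D : Digraph V) : Prop :=
  ∀ ⦃u v : V⦄, D.Adj u v → ¬ D.Adj v u

/-- The (first) out-neighborhood `N⁺(v)`. -/
def outNbhd {V : Type*} (D : Digraph V) (v : V) : Set V :=
  {w | D.Adj v w}

/-- The (first) in-neighborhood `N⁻(v)`. -/
def inNbhd {V : Type*} (D : Digraph V) (v : V) : Set V :=
  {u | D.Adj u v}

/-- The second out-neighborhood `N⁺⁺(v)`: the vertices at distance exactly two from `v`. -/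
def secondOutNbhd {V : Type*} (D : Digraph V) (v : V) : Set V :=
  {w | w ≠ v ∧ ¬ D.Adj v w ∧ ∃ u, D.Adj v u ∧ D.Adj u w}

/-- The out-degree `d⁺(v)`. -/
noncomputable def outDeg {V : Type*} (D : Digraph V) (v : V) : ℕ :=
  (D.outNbhd v).ncard

/-- The in-degree `d⁻(v)`. -/
noncomputable def inDeg {V : Type*} (D : Digraph V) (v : V) : ℕ :=
  (D.inNbhd v).ncard

/-- The second out-degree `d⁺⁺(v)`. -/
noncomputable def secondOutDeg {V : Type*} (D : Digraph V) (v : V) : ℕ :=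
  (D.secondOutNbhd v).ncard

/-- The minimum out-degree `δ⁺` of a (finite, nonempty) digraph. -/
noncomputable def minOutDeg {V : Type*} (D : Digraph V) : ℕ :=
  ⨅ v, D.outDeg v

/-- The minimum in-degree `δ⁻` of a (finite, nonempty) digraph. -/
noncomputable def minInDeg {V : Type*} (D : Digraph V) : ℕ :=
  ⨅ v, D.inDeg v

/-- The restriction `D[K]` of `D` to a set of vertices `K`. -/
def restrict {V : Type*} (D : Digraph V) (K : Set V) : Digraph K where
  Adj u v := D.Adj u v

/-- The missing graph: its edges are the pairs of distinct vertices of `D` not joined by an arc.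
(The non-whole vertices of `D` are exactly the vertices in the support of this graph.) -/
def missingGraph {V : Type*} (D : Digraph V) : SimpleGraph V where
  Adj u v := u ≠ v ∧ ¬ D.Adj u v ∧ ¬ D.Adj v u
  symm := ⟨fun _ _ h => ⟨h.1.symm, h.2.2, h.2.1⟩⟩
  loopless := ⟨fun _ h => h.1 rfl⟩

/-- The pair `e = {x₁, y₁}` loses to the pair `f = {x₂, y₂}`: for some labelling of the endpoints,
`x₁ → x₂`, `y₂ ∉ N⁺(x₁) ∪ N⁺⁺(x₁)`, `y₁ → y₂` and `x₂ ∉ N⁺(y₁) ∪ N⁺⁺(y₁)`. -/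
def LosesTo {V : Type*} (D : Digraph V) (e f : Sym2 V) : Prop :=
  ∃ x₁ y₁ x₂ y₂ : V, e = s(x₁, y₁) ∧ f = s(x₂, y₂) ∧
    D.Adj x₁ x₂ ∧ y₂ ∉ D.outNbhd x₁ ∪ D.secondOutNbhd x₁ ∧
    D.Adj y₁ y₂ ∧ x₂ ∉ D.outNbhd y₁ ∪ D.secondOutNbhd y₁

/-- The dependency digraph `Δ`: its vertices are the missing edges of `D`, with an arc from `e`
to `f` whenever `e` loses to `f`. -/
def dependency {V : Type*} (D : Digraph V) : Digraph D.missingGraph.edgeSet where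
  Adj e f := D.LosesTo e f

/-- The connected components of a digraph, i.e. those of its underlying undirected graph. -/
abbrev Component {V : Type*} (D : Digraph V) : Type _ :=
  D.toSimpleGraphInclusive.ConnectedComponent

end Digraph

namespace SimpleGraph

/-- All edges of `S` share one vertex, the center; isolated vertices of the ambient type are not
regarded as vertices of the star, and a star may have no edges. -/
def IsStarGraph {V : Type*} (S : SimpleGraph V) : Prop :=
  ∃ x : V, ∀ ⦃u v : V⦄, S.Adj u v → u = x ∨ v = x

/-- The edges of `M` are pairwise independent: no two of them have a vertex in common. -/
def IsMatchingGraph {V : Type*} (M : SimpleGraph V) : Prop :=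
  ∀ ⦃u v w : V⦄, M.Adj u v → M.Adj u w → v = w

end SimpleGraph

/-! Label the endpoints so that a losing `x y` to `x' y'` is `Beats`. The missing graph is so sparse
that this forces a directed 4-cycle x → x' → y → y' → x, and any out-neighbor of `x` that is joined
to `y'` is dominated by `y'`. Adjacency to an outside vertex therefore travels along the dependency
digraph.

Positive in- and out-degrees make the chains of pairs leaving the star return to it. The vertices on
these chains form a module `K` in which the center `x` has at least as many second out-neighbors as
out-neighbors, counted inside `K` (`IsBalanced.exists_isModule`). Such a module may be replaced by a
transitive tournament (`IsModule.exists_le_of_transitiveOn`): a good vertex of the new digraph lying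
in `K` is traded for `x`, and one outside `K` stays good. What remains misses only a matching.

For a matching, the labelled losing relation is a partial injection, so it splits into paths and
cycles. An edge on a cycle is a one-edge star satisfying the same degree conditions, so cycles can
be collapsed too. Once only paths remain, the missing edges are oriented along them to give a
tournament, and the last vertex of a median order, after possibly reversing one added arc at it, is
good in `D` (`exists_le_of_acc`). -/

namespace Digraph

/-! ### Median orders of tournaments. -/

section MedianOrder

variable {V : Type*}

open Classical in
/-- The number of entries of a list that satisfy `p`. -/
noncomputable def countOf (p : V → Prop) (L : List V) : ℕ :=
  L.countP fun v => decide (p v)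

@[simp] theorem countOf_nil (p : V → Prop) : countOf p [] = 0 := by simp [countOf]

theorem countOf_append (p : V → Prop) (A B : List V) :
    countOf p (A ++ B) = countOf p A + countOf p B := by simp [countOf]

open Classical in
theorem countOf_cons (p : V → Prop) (x : V) (A : List V) :
    countOf p (x :: A) = countOf p A + if p x then 1 else 0 := by
  simp [countOf, List.countP_cons]

theorem countOf_perm (p : V → Prop) {A B : List V} (h : A.Perm B) : countOf p A = countOf p B :=
  h.countP_eq _

theorem countOf_mono {p q : V → Prop} {A : List V} (h : ∀ v ∈ A, p v → q v) :
    countOf p A ≤ countOf q A :=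
  List.countP_mono_left (by simpa using h)

theorem countOf_eq_ncard (p : V → Prop) {A : List V} (hA : A.Nodup) (hall : ∀ v, v ∈ A) :
    countOf p A = {v | p v}.ncard := by
  classical
  rw [countOf, List.countP_eq_length_filter, ← List.toFinset_card_of_nodup (hA.filter _),
    ← Set.ncard_coe_finset]
  congr 1
  ext v
  simp [hall v]

/-- The number of forward arcs of an enumeration of vertices. -/
noncomputable def forwardArcs (T : V → V → Prop) : List V → ℕ
  | [] => 0
  | x :: L => countOf (T x) L + forwardArcs T L

/-- The number of arcs from the first list to the second one. -/
noncomputable def crossArcs (T : V → V → Prop) (A B : List V) : ℕ :=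
  (A.map fun a => countOf (T a) B).sum

theorem crossArcs_perm (T : V → V → Prop) {A A' B B' : List V} (hA : A.Perm A') (hB : B.Perm B') :
    crossArcs T A B = crossArcs T A' B' := by
  unfold crossArcs
  rw [(hA.map _).sum_eq]
  simp only [countOf_perm _ hB]

theorem crossArcs_singleton (T : V → V → Prop) (A : List V) (x : V) :
    crossArcs T A [x] = countOf (fun v => T v x) A := by
  induction A with
  | nil => simp [crossArcs]
  | cons a A ih =>
    rw [countOf_cons, ← ih]
    simp [crossArcs, countOf_cons, add_comm]

theorem forwardArcs_append (T : V → V → Prop) (A B : List V) :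
    forwardArcs T (A ++ B) = forwardArcs T A + forwardArcs T B + crossArcs T A B := by
  induction A with
  | nil => simp [crossArcs, forwardArcs]
  | cons a A ih =>
    simp only [List.cons_append, forwardArcs, ih, countOf_append, crossArcs, List.map_cons,
      List.sum_cons]
    omega

theorem forwardArcs_le_iff (T : V → V → Prop) (A C : List V) {X Y : List V} (h : X.Perm Y) :
    forwardArcs T (A ++ X ++ C) ≤ forwardArcs T (A ++ Y ++ C) ↔
      forwardArcs T X ≤ forwardArcs T Y := by
  simp only [forwardArcs_append, crossArcs_perm T (List.Perm.refl A) h,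
    crossArcs_perm T (h.append_left A) (List.Perm.refl C)]
  omega

/-- The feedback property: in every interval of the enumeration, the last vertex has at least as
many in-neighbors as out-neighbors. -/
def HasFeedback (T : V → V → Prop) (L : List V) : Prop :=
  ∀ A x B C, L = A ++ (B ++ [x]) ++ C → countOf (T x) B ≤ countOf (fun v => T v x) B

/-- An enumeration maximizing the number of forward arcs works: moving the last vertex of an
interval to its front trades its in-neighbors there for its out-neighbors and changes no other arc.
-/
theorem exists_hasFeedback [Finite V] (T : V → V → Prop) :
    ∃ L : List V, L.Nodup ∧ (∀ v, v ∈ L) ∧ HasFeedback T L := by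
  classical
  have := Fintype.ofFinite V
  set U : List V := Finset.univ.toList with hU
  obtain ⟨L, hL, hmax⟩ := U.permutations.toFinset.exists_max_image (forwardArcs T)
    ⟨U, by simp⟩
  simp only [List.mem_toFinset, List.mem_permutations] at hL hmax
  refine ⟨L, hL.nodup_iff.2 (Finset.nodup_toList _), fun v => hL.mem_iff.2 (by simp [hU]), ?_⟩
  intro A x B C
  have hp : (x :: B).Perm (B ++ [x]) := (List.perm_append_singleton x B).symm
  have h1 : forwardArcs T (x :: B) = countOf (T x) B + forwardArcs T B := rfl
  have h2 : forwardArcs T (B ++ [x]) = forwardArcs T B + countOf (fun v => T v x) B := by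
    rw [forwardArcs_append, crossArcs_singleton]
    simp [forwardArcs]
  rintro rfl
  have := (forwardArcs_le_iff T A C hp).1
    (hmax _ (((hp.append_left A).append_right C).trans hL))
  omega

theorem HasFeedback.of_suffix {T : V → V → Prop} {A L : List V} (h : HasFeedback T (A ++ L)) :
    HasFeedback T L := by
  rintro A' x B C rfl
  exact h (A ++ A') x B C (by simp)

/-- Reversing arcs out of the last vertex preserves the feedback property. -/
theorem HasFeedback.mono_last {T T' : V → V → Prop} {L : List V} {f : V} (hf : f ∉ L)
    (h : HasFeedback T (L ++ [f])) (heq : ∀ u v, u ≠ f → v ≠ f → (T' u v ↔ T u v))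
    (hin : ∀ u, T u f → T' u f) (hout : ∀ u, T' f u → T f u) : HasFeedback T' (L ++ [f]) := by
  intro A x B C hL
  have hle := h A x B C hL
  by_cases hx : x = f
  · subst hx
    exact (countOf_mono fun v _ => hout v).trans (hle.trans (countOf_mono fun v _ => hin v))
  · have hfB : f ∉ B := by
      rcases List.eq_nil_or_concat C with rfl | ⟨C', c, rfl⟩
      · rw [List.append_nil, ← List.append_assoc] at hL
        exact absurd (by simpa using (List.append_inj' hL rfl).2.symm) hx
      · rw [List.concat_eq_append, ← List.append_assoc] at hL
        rw [(List.append_inj' hL rfl).1] at hf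
        simp at hf
        tauto
    have hB : ∀ v ∈ B, v ≠ f := fun v hv e => hfB (e ▸ hv)
    exact (countOf_mono fun v hv => (heq x v hx (hB v hv)).1).trans
      (hle.trans (countOf_mono fun v hv => (heq v x (hB v hv) hx).2))

theorem exists_first_of_mem {p : V → Prop} {L : List V} (h : ∃ y ∈ L, p y) :
    ∃ B y C, L = B ++ y :: C ∧ p y ∧ ∀ z ∈ B, ¬ p z := by
  induction L with
  | nil => simp at h
  | cons a L ih =>
    by_cases ha : p a
    · exact ⟨[], a, L, rfl, ha, by simp⟩
    · obtain ⟨B, y, C, rfl, hy, hB⟩ := ih (by simpa [ha] using h)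
      exact ⟨a :: B, y, C, rfl, hy, by simpa [ha] using hB⟩

/-- The last vertex of an enumeration of a tournament with the feedback property has at least as
many second out-neighbors as out-neighbors. -/
theorem HasFeedback.countOf_le {T : V → V → Prop} (hor : ∀ u v, T u v → ¬ T v u)
    (htot : ∀ u v, u ≠ v → T u v ∨ T v u) {f : V} (L : List V) (hf : f ∉ L)
    (h : HasFeedback T (L ++ [f])) :
    countOf (T f) L ≤ countOf (fun w => w ≠ f ∧ ¬ T f w ∧ ∃ u, T f u ∧ T u w) L := by
  induction hn : L.length using Nat.strong_induction_on generalizing L with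
  | _ n ih =>
  by_cases hbad : ∃ y ∈ L, T y f ∧ ¬ ∃ u, T f u ∧ T u y
  -- Cut at the first in-neighbor `y` of `f` that no path of length two from `f` reaches. Induction
  -- handles `C`. In `B`, out-neighbors of `f` are out-neighbors of `y`, which feedback at `y`
  -- bounds by the in-neighbors of `y`; these are not dominated by `f` and come before the first bad
  -- vertex, so they are second out-neighbors of `f`.
  · obtain ⟨B, y, C, rfl, ⟨hyf, hy⟩, hB⟩ := exists_first_of_mem hbad
    push Not at hy
    have hC := ih C.length (by simp at hn; omega) C (by simp at hf; tauto)
      (HasFeedback.of_suffix (A := B ++ [y]) (by simpa using h)) rfl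
    have h1 : countOf (T f) B ≤ countOf (T y) B := countOf_mono fun v _ hv =>
      (htot y v (fun e => hor _ _ hyf (e ▸ hv))).resolve_right (hy v hv)
    have h2 : countOf (T y) B ≤ countOf (fun v => T v y) B :=
      (h [] y B (C ++ [f])) (by simp)
    have h3 : countOf (fun v => T v y) B ≤
        countOf (fun w => w ≠ f ∧ ¬ T f w ∧ ∃ u, T f u ∧ T u w) B := by
      refine countOf_mono fun v hv hvy => ?_
      have hvf : v ≠ f := by rintro rfl; simp at hf; tauto
      have hfv : ¬ T f v := fun hc => hy v hc hvy
      refine ⟨hvf, hfv, ?_⟩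
      by_contra hc
      exact hB v hv ⟨(htot v f hvf).resolve_right hfv, hc⟩
    rw [countOf_append, countOf_append, countOf_cons, countOf_cons, if_neg (hor _ _ hyf)]
    omega
  · push Not at hbad
    calc countOf (T f) L ≤ countOf (fun v => T v f) L := (h [] f L []) (by simp)
      _ ≤ _ := countOf_mono fun v hv hvf =>
        ⟨fun e => hf (e ▸ hv), hor _ _ hvf, hbad v hv hvf⟩

end MedianOrder

end Digraph

namespace Digraph

/-! ### The losing relation on labelled missing edges. -/

section Beats

variable {V : Type*} {D : Digraph V}

/-- The missing pair `x y` loses to the missing pair `x' y'` with this labelling of endpoints. -/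
structure Beats (D : Digraph V) (x y x' y' : V) : Prop where
  left : D.missingGraph.Adj x y
  right : D.missingGraph.Adj x' y'
  adj₁ : D.Adj x x'
  adj₂ : D.Adj y y'
  not_adj₁ : ¬ D.Adj x y'
  not_adj₂ : ¬ D.Adj y x'
  not_path₁ : ∀ u, D.Adj x u → ¬ D.Adj u y'
  not_path₂ : ∀ u, D.Adj y u → ¬ D.Adj u x'

/-- Every vertex except possibly `x` belongs to at most one missing edge. -/
def MissesAtMostOne (D : Digraph V) (x : V) : Prop :=
  ∀ ⦃u v w⦄, u ≠ x → D.missingGraph.Adj u v → D.missingGraph.Adj u w → v = w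

theorem Beats.swap {x y x' y' : V} (h : D.Beats x y x' y') : D.Beats y x y' x' :=
  ⟨h.left.symm, h.right.symm, h.adj₂, h.adj₁, h.not_adj₂, h.not_adj₁, h.not_path₂, h.not_path₁⟩

theorem missing_of_not_adj {u v : V} (h : u ≠ v) (h₁ : ¬ D.Adj u v) (h₂ : ¬ D.Adj v u) :
    D.missingGraph.Adj u v := ⟨h, h₁, h₂⟩

theorem IsOriented.ne_of_adj (hD : D.IsOriented) {u v : V} (h : D.Adj u v) : u ≠ v := by
  rintro rfl
  exact hD h h

theorem losesTo_iff {x y : V} (f : Sym2 V) (hxy : D.missingGraph.Adj x y)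
    (hf : f ∈ D.missingGraph.edgeSet) :
    D.LosesTo s(x, y) f ↔ ∃ x' y', f = s(x', y') ∧ D.Beats x y x' y' := by
  have key : ∀ {a b a' b' : V}, D.missingGraph.Adj a b → D.Adj a a' →
      b' ∉ D.outNbhd a ∪ D.secondOutNbhd a → D.Adj b b' →
      ¬ D.Adj a b' ∧ ∀ u, D.Adj a u → ¬ D.Adj u b' := by
    intro a b a' b' hab haa' hb' hbb'
    simp only [outNbhd, secondOutNbhd, Set.mem_union, Set.mem_ofPred_eq, not_or] at hb'
    refine ⟨hb'.1, fun u hu hub => hb'.2 ⟨?_, hb'.1, u, hu, hub⟩⟩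
    rintro rfl
    exact hab.2.2 hbb'
  have key' : ∀ {a b' : V}, ¬ D.Adj a b' → (∀ u, D.Adj a u → ¬ D.Adj u b') →
      b' ∉ D.outNbhd a ∪ D.secondOutNbhd a := by
    intro a b' h1 h2
    simp only [outNbhd, secondOutNbhd, Set.mem_union, Set.mem_ofPred_eq, not_or]
    exact ⟨h1, fun ⟨_, _, u, hu, hub⟩ => h2 u hu hub⟩
  constructor
  · rintro ⟨x₁, y₁, x₂, y₂, he, rfl, h1, h2, h3, h4⟩
    have hm : D.missingGraph.Adj x₁ y₁ := by
      rw [← SimpleGraph.mem_edgeSet, ← he]; exact hxy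
    have h5 := key hm h1 h2 h3
    have h6 := key hm.symm h3 h4 h1
    have hb : D.Beats x₁ y₁ x₂ y₂ := ⟨hm, hf, h1, h3, h5.1, h6.1, h5.2, h6.2⟩
    rcases Sym2.eq_iff.1 he with ⟨rfl, rfl⟩ | ⟨rfl, rfl⟩
    · exact ⟨x₂, y₂, rfl, hb⟩
    · exact ⟨y₂, x₂, Sym2.eq_swap, hb.swap⟩
  · rintro ⟨x', y', rfl, h⟩
    exact ⟨x, y, x', y', rfl, rfl, h.adj₁, key' h.not_adj₁ h.not_path₁, h.adj₂,
      key' h.not_adj₂ h.not_path₂⟩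

/-- A missing graph with at most one vertex of degree at least two has no path of length three. -/
theorem MissesAtMostOne.eq_or_eq {x : V} (hx : D.MissesAtMostOne x) {a b c d : V}
    (hab : D.missingGraph.Adj a b) (hbc : D.missingGraph.Adj b c) (hcd : D.missingGraph.Adj c d) :
    a = c ∨ b = d := by
  by_cases hb : b = x
  · exact Or.inr (hx (fun hc => hbc.1 (hb.trans hc.symm)) hbc.symm hcd)
  · exact Or.inl (hx hb hab.symm hbc)

/-- Otherwise `b a'` is missing too, and a, b, a', b' is a path of three missing edges. -/
theorem Beats.back {x : V} (hD : D.IsOriented) (hx : D.MissesAtMostOne x)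
    {a b a' b' : V} (h : D.Beats a b a' b') : D.Adj a' b := by
  by_contra hc
  have hne : b ≠ a' := by
    rintro rfl
    exact h.left.2.1 h.adj₁
  rcases hx.eq_or_eq h.left (missing_of_not_adj hne h.not_adj₂ hc) h.right with rfl | rfl
  · exact hD h.adj₁ h.adj₁
  · exact hD h.adj₂ h.adj₂

theorem Beats.back' {x : V} (hD : D.IsOriented) (hx : D.MissesAtMostOne x)
    {a b a' b' : V} (h : D.Beats a b a' b') : D.Adj b' a :=
  h.swap.back hD hx

/-- An arc between `c` and `d'`, in either direction, would complete a forbidden path of length two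
from `a` or `b`. So `c d'` is missing and d, c, d', c' is a path of missing edges. -/
theorem Beats.eq_or_eq_right {x : V} (hD : D.IsOriented) (hx : D.MissesAtMostOne x)
    {a b c d c' d' : V} (h : D.Beats a b c d) (h' : D.Beats a b c' d') :
    d = d' ∨ c = c' := by
  have hne : c ≠ d' := by
    rintro rfl
    exact hD h.adj₁ (h'.back' hD hx)
  have hm : D.missingGraph.Adj c d' := missing_of_not_adj hne
    (h'.not_path₁ _ h.adj₁) (h.not_path₂ _ h'.adj₂)
  exact hx.eq_or_eq h.right.symm hm h'.right.symm

theorem Beats.eq_or_eq_left {x : V} (hD : D.IsOriented) (hx : D.MissesAtMostOne x)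
    {a b a' b' c d : V} (h : D.Beats a b c d) (h' : D.Beats a' b' c d) :
    a = a' ∨ b = b' := by
  have hne : b ≠ a' := by
    rintro rfl
    exact hD h'.adj₁ (h.back hD hx)
  have hm : D.missingGraph.Adj b a' := missing_of_not_adj hne
    (fun hc => h.not_path₂ _ hc h'.adj₁) (fun hc => h'.not_path₁ _ hc h.adj₂)
  exact hx.eq_or_eq h.left hm h'.left

/-- If `a b` loses to `a' b'`, every vertex dominated by `a` is dominated by `b'`, unless it is
in a missing edge with `b'`. -/
theorem Beats.adj_of_adj {a b a' b' v : V} (h : D.Beats a b a' b') (hv : D.Adj a v)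
    (hadj : D.Adj b' v ∨ D.Adj v b') : D.Adj b' v :=
  hadj.resolve_right (h.not_path₁ v hv)

end Beats

end Digraph

namespace Digraph

/-! ### Missing matchings whose losing relation has no cycle. -/

section Matching

variable {V : Type*} {D : Digraph V}

/-- `(a, b)` is a convenient orientation of the missing edge `a b`: every in-neighbor of `a` has `b`
as a first or second out-neighbor. -/
def Convenient (D : Digraph V) (a b : V) : Prop :=
  ∀ v, D.Adj v a → D.Adj v b ∨ ∃ u, D.Adj v u ∧ D.Adj u b

/-- The orientation of missing edges which starts with convenient orientations of the edges that
lose to nothing and is propagated along the losing relation; `ℓ` breaks ties. -/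
inductive Propagated (D : Digraph V) (ℓ : V → ℕ) : V → V → Prop
  | base {a b : V} : D.missingGraph.Adj a b → (∀ v w, ¬ D.Beats v w a b) → D.Convenient a b →
      (D.Convenient b a → ℓ a < ℓ b) → Propagated D ℓ a b
  | step {v w a b : V} : D.Beats v w a b → Propagated D ℓ v w → Propagated D ℓ a b

theorem Propagated.missing {ℓ : V → ℕ} {a b : V} (h : D.Propagated ℓ a b) :
    D.missingGraph.Adj a b := by
  cases h with
  | base h => exact h
  | step h => exact h.right

theorem Beats.eq_right (hD : D.IsOriented) (hM : ∀ x, D.MissesAtMostOne x) {a b c d c' d' : V}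
    (h : D.Beats a b c d) (h' : D.Beats a b c' d') : c = c' ∧ d = d' := by
  have hM' : ∀ ⦃u v w⦄, D.missingGraph.Adj u v → D.missingGraph.Adj u w → v = w :=
    fun u v w huv => hM v huv.ne huv
  rcases h.eq_or_eq_right hD (hM a) h' with rfl | rfl
  · exact ⟨hM' h.right.symm h'.right.symm, rfl⟩
  · exact ⟨rfl, hM' h.right h'.right⟩

theorem Beats.eq_left (hD : D.IsOriented) (hM : ∀ x, D.MissesAtMostOne x) {a b a' b' c d : V}
    (h : D.Beats a b c d) (h' : D.Beats a' b' c d) : a = a' ∧ b = b' := by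
  have hM' : ∀ ⦃u v w⦄, D.missingGraph.Adj u v → D.missingGraph.Adj u w → v = w :=
    fun u v w huv => hM v huv.ne huv
  rcases h.eq_or_eq_left hD (hM a) h' with rfl | rfl
  · exact ⟨rfl, hM' h.left h'.left⟩
  · exact ⟨hM' h.left.symm h'.left.symm, rfl⟩

/-- If neither orientation of a missing edge is convenient, some missing edge loses to it. -/
theorem exists_beats_of_not_convenient {a b : V} (hab : D.missingGraph.Adj a b) (h₁ : ¬ D.Convenient a b)
    (h₂ : ¬ D.Convenient b a) : ∃ v w, D.Beats v w a b := by
  simp only [Convenient, not_forall, not_or, not_exists, not_and] at h₁ h₂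
  obtain ⟨v, hva, hvb, hv⟩ := h₁
  obtain ⟨w, hwb, hwa, hw⟩ := h₂
  have hne : v ≠ w := by
    rintro rfl
    exact hvb hwb
  exact ⟨v, w, missing_of_not_adj hne (fun hc => hv w hc hwb) (fun hc => hw v hc hva), hab,
    hva, hwb, hvb, hwa, hv, hw⟩

variable {ℓ : V → ℕ}

theorem propagated_or (hℓ : Function.Injective ℓ) {p : V × V}
    (hacc : Acc (fun p q : V × V => D.Beats p.1 p.2 q.1 q.2) p)
    (hp : D.missingGraph.Adj p.1 p.2) :
    D.Propagated ℓ p.1 p.2 ∨ D.Propagated ℓ p.2 p.1 := by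
  induction hacc with
  | intro p _ ih =>
    by_cases h : ∃ v w, D.Beats v w p.1 p.2
    · obtain ⟨v, w, hvw⟩ := h
      exact (ih (v, w) hvw hvw.left).imp (.step hvw) (.step hvw.swap)
    · push Not at h
      have h' : ∀ v w, ¬ D.Beats v w p.2 p.1 := fun v w hc => h w v hc.swap
      rcases lt_or_gt_of_ne (fun e => hp.ne (hℓ e)) with hlt | hlt
      · by_cases hc : D.Convenient p.1 p.2
        · exact .inl (.base hp h hc fun _ => hlt)
        · by_cases hc' : D.Convenient p.2 p.1
          · exact .inr (.base hp.symm h' hc' fun hc'' => absurd hc'' hc)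
          · obtain ⟨v, w, hvw⟩ := exists_beats_of_not_convenient hp hc hc'
            exact absurd hvw (h v w)
      · by_cases hc : D.Convenient p.2 p.1
        · exact .inr (.base hp.symm h' hc fun _ => hlt)
        · by_cases hc' : D.Convenient p.1 p.2
          · exact .inl (.base hp h hc' fun hc'' => absurd hc'' hc)
          · obtain ⟨v, w, hvw⟩ := exists_beats_of_not_convenient hp hc' hc
            exact absurd hvw (h v w)

/-- In a matching the labelled predecessor of a pair is unique, so two opposite orientations trace
back to opposite orientations of one initial edge, where the tie-break excludes them. -/
theorem Propagated.asymm (hD : D.IsOriented) (hM : ∀ x, D.MissesAtMostOne x) {a b : V}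
    (h : D.Propagated ℓ a b) : ¬ D.Propagated ℓ b a := by
  induction h with
  | base _ hno hc hlt =>
    intro h'
    cases h' with
    | base _ _ hc' hlt' => exact lt_asymm (hlt hc') (hlt' hc)
    | step hb _ => exact hno _ _ hb.swap
  | step hb _ ih =>
    intro h'
    cases h' with
    | base _ hno _ _ => exact hno _ _ hb.swap
    | step hb' h' =>
      obtain ⟨rfl, rfl⟩ := hb.eq_left hD hM hb'.swap
      exact ih h'

/-- A propagated orientation `(a, b)` fails to be convenient only because of the edge losing
to `a b`. -/
theorem Propagated.exists_beats (hM : ∀ x, D.MissesAtMostOne x) {a b v : V}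
    (h : D.Propagated ℓ a b) (hva : D.Adj v a) (hvb : ¬ D.Adj v b)
    (hv : ∀ u, D.Adj v u → ¬ D.Adj u b) : ∃ z, D.Beats v z a b ∧ D.Propagated ℓ v z := by
  cases h with
  | base _ _ hc _ =>
    rcases hc v hva with h | ⟨u, hu, hub⟩
    · exact absurd h hvb
    · exact absurd hub (hv u hu)
  | step hb h =>
    rename_i v' w'
    have hne : v ≠ w' := by
      rintro rfl
      exact hb.not_adj₂ hva
    have hm : D.missingGraph.Adj v w' := missing_of_not_adj hne
      (fun hc => hv _ hc hb.adj₂) (fun hc => hb.not_path₂ _ hc hva)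
    obtain rfl := hM v' hb.left.symm.ne hm.symm hb.left.symm
    exact ⟨w', hb, h⟩

theorem exists_injective_nat (V : Type*) [Finite V] : ∃ ℓ : V → ℕ, Function.Injective ℓ := by
  obtain ⟨n, ⟨e⟩⟩ := Finite.exists_equiv_fin V
  exact ⟨fun v => (e v : ℕ), Fin.val_injective.comp e.injective⟩

theorem exists_le_of_acc [Finite V] [Nonempty V] (hD : D.IsOriented)
    (hM : ∀ x, D.MissesAtMostOne x)
    (hacc : ∀ a b, D.missingGraph.Adj a b →
      Acc (fun p q : V × V => D.Beats p.1 p.2 q.1 q.2) (a, b)) :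
    ∃ v, D.outDeg v ≤ D.secondOutDeg v := by
  obtain ⟨ℓ, hℓ⟩ := exists_injective_nat V
  have hM' : ∀ ⦃u v w⦄, D.missingGraph.Adj u v → D.missingGraph.Adj u w → v = w :=
    fun u v w huv => hM v huv.ne huv
  set T : V → V → Prop := fun u v => D.Adj u v ∨ D.Propagated ℓ u v with hT
  have hTor : ∀ u v, T u v → ¬ T v u := by
    rintro u v (h | h) (h' | h')
    · exact hD h h'
    · exact h'.missing.2.2 h
    · exact h.missing.2.2 h'
    · exact h.asymm hD hM h'
  have hTtot : ∀ u v, u ≠ v → T u v ∨ T v u := by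
    intro u v huv
    by_cases h1 : D.Adj u v
    · exact .inl (.inl h1)
    by_cases h2 : D.Adj v u
    · exact .inr (.inl h2)
    have hm := missing_of_not_adj huv h1 h2
    exact (propagated_or hℓ (hacc u v hm) hm).imp .inr .inr
  obtain ⟨L, hnd, hall, hfeed⟩ := exists_hasFeedback T
  rcases List.eq_nil_or_concat L with rfl | ⟨L, f, rfl⟩
  · exact absurd (hall (Classical.arbitrary V)) (by simp)
  rw [List.concat_eq_append] at hnd hall hfeed
  have hfL : f ∉ L := by
    have := List.nodup_append.1 hnd
    intro hc
    exact this.2.2 f hc f (by simp) rfl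
  have hdeg : ∀ T' : V → V → Prop, (∀ u v, T' u v → ¬ T' v u) → (∀ u v, u ≠ v → T' u v ∨ T' v u) →
      HasFeedback T' (L ++ [f]) →
      {w | T' f w}.ncard ≤ {w | w ≠ f ∧ ¬ T' f w ∧ ∃ u, T' f u ∧ T' u w}.ncard := by
    intro T' h1 h2 h3
    rw [← countOf_eq_ncard _ hnd hall, ← countOf_eq_ncard _ hnd hall, countOf_append,
      countOf_append]
    have := HasFeedback.countOf_le h1 h2 L hfL h3
    have h4 : countOf (T' f) [f] = 0 := by
      rw [countOf_cons, if_neg (fun h => h1 _ _ h h)]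
      simp
    omega
  refine ⟨f, ?_⟩
  -- If the missing edge at `f` points out of `f` and loses to `a b`, passing from `T` to `D` costs
  -- exactly the out-neighbor `z` and at most the second out-neighbor `b`, so the inequality
  -- survives.
  by_cases hcase : ∃ z a b, D.Beats f z a b ∧ D.Propagated ℓ f z
  · obtain ⟨z, a, b, hb, hz⟩ := hcase
    have h := hdeg T hTor hTtot hfeed
    have h1 : {w | T f w} = insert z (D.outNbhd f) := by
      ext w
      simp only [hT, outNbhd, Set.mem_insert_iff, Set.mem_ofPred_eq]
      constructor
      · rintro (h | h)
        · exact .inr h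
        · exact .inl (hM' h.missing hz.missing)
      · rintro (rfl | h)
        · exact .inr hz
        · exact .inl h
    have h2 : {w | w ≠ f ∧ ¬ T f w ∧ ∃ u, T f u ∧ T u w} ⊆ insert b (D.secondOutNbhd f) := by
      rintro w ⟨hwf, hfw, u, hfu, huw⟩
      simp only [hT, not_or] at hfw
      by_cases hw : ∃ u, D.Adj f u ∧ D.Adj u w
      · exact .inr ⟨hwf, hfw.1, hw⟩
      push Not at hw
      left
      rcases hfu with hfu | hfu
      · rcases huw with huw | huw
        · exact absurd huw (hw u hfu)
        · obtain ⟨z', hb', hz'⟩ := huw.exists_beats hM hfu hfw.1 hw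
          obtain rfl := hM' hz'.missing hz.missing
          exact (hb.eq_right hD hM hb').2.symm
      · obtain rfl := hM' hfu.missing hz.missing
        rcases huw with huw | huw
        · have hne : a ≠ w := by
            rintro rfl
            exact hfw.1 hb.adj₁
          exact hM' (missing_of_not_adj hne (hw a hb.adj₁) (hb.not_path₂ w huw)) hb.right
        · exact absurd (hM' huw.missing hz.missing.symm) hwf
    have h3 : z ∉ D.outNbhd f := hz.missing.2.1
    rw [h1, Set.ncard_insert_of_notMem h3 (Set.toFinite _)] at h
    have h4 := (Set.ncard_le_ncard h2 (Set.toFinite _)).trans (Set.ncard_insert_le _ _)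
    unfold outDeg secondOutDeg
    omega
  · push Not at hcase
    -- Otherwise point the missing edge at `f`, if any, into `f`. Feedback at the last vertex only
    -- improves, the out-neighborhood of `f` is that of `D`, and no spurious second out-neighbor
    -- appears.
    set T' : V → V → Prop := fun u v => D.Adj u v ∨ (D.Propagated ℓ u v ∧ u ≠ f) ∨
      (D.Propagated ℓ v u ∧ v = f) with hT'
    have h := hdeg T' ?_ ?_ ?_
    · have h1 : {w | T' f w} = D.outNbhd f := by
        ext w
        simp only [hT', outNbhd, Set.mem_ofPred_eq]
        constructor
        · rintro (h | ⟨-, h⟩ | ⟨h, rfl⟩)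
          · exact h
          · exact absurd rfl h
          · exact absurd rfl h.missing.ne
        · exact .inl
      have h2 : {w | w ≠ f ∧ ¬ T' f w ∧ ∃ u, T' f u ∧ T' u w} ⊆ D.secondOutNbhd f := by
        rintro w ⟨hwf, hfw, u, hfu, huw⟩
        have hfu' : D.Adj f u := (Set.ext_iff.1 h1 u).1 hfu
        have hfw' : ¬ D.Adj f w := fun h => hfw ((Set.ext_iff.1 h1 w).2 h)
        by_cases hw : ∃ u, D.Adj f u ∧ D.Adj u w
        · exact ⟨hwf, hfw', hw⟩
        push Not at hw
        rcases huw with huw | ⟨huw, -⟩ | ⟨-, huw⟩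
        · exact absurd huw (hw u hfu')
        · obtain ⟨z', hb', hz'⟩ := huw.exists_beats hM hfu' hfw' hw
          exact absurd hz' (hcase z' u w hb')
        · exact absurd huw hwf
      rw [h1] at h
      exact h.trans (Set.ncard_le_ncard h2 (Set.toFinite _))
    · rintro u v (h | ⟨h, h1⟩ | ⟨h, h1⟩) (h' | ⟨h', h2⟩ | ⟨h', h2⟩)
      · exact hD h h'
      · exact h'.missing.2.2 h
      · exact h'.missing.2.1 h
      · exact h.missing.2.2 h'
      · exact h.asymm hD hM h'
      · exact h1 h2
      · exact h.missing.2.1 h'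
      · exact h2 h1
      · exact h.missing.ne (h1.trans h2.symm)
    · intro u v huv
      rcases hTtot u v huv with (h | h) | (h | h)
      · exact .inl (.inl h)
      · by_cases hu : u = f
        · exact .inr (.inr (.inr ⟨h, hu⟩))
        · exact .inl (.inr (.inl ⟨h, hu⟩))
      · exact .inr (.inl h)
      · by_cases hv : v = f
        · exact .inl (.inr (.inr ⟨h, hv⟩))
        · exact .inr (.inr (.inl ⟨h, hv⟩))
    · refine hfeed.mono_last hfL (fun u v hu hv => ?_) (fun u hu => ?_) (fun u hu => ?_)
      · simp [hT, hT', hu, hv]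
      · rcases hu with h | h
        · exact .inl h
        · by_cases hc : u = f
          · exact absurd hc h.missing.ne
          · exact .inr (.inl ⟨h, hc⟩)
      · rcases hu with h | ⟨-, h⟩ | ⟨h, rfl⟩
        · exact .inl h
        · exact absurd rfl h
        · exact absurd rfl h.missing.ne

end Matching

end Digraph

namespace Digraph

/-! ### The module generated by a star. -/

section Balanced

/-- An injective successor map on a finite set is surjective. -/
theorem exists_pred_of_exists_succ {α : Type*} [Finite α] {r : α → α → Prop} {E : Set α}
    (hs : ∀ e ∈ E, ∃ e' ∈ E, r e e')
    (hinj : ∀ e₁ ∈ E, ∀ e₂ ∈ E, ∀ e' ∈ E, r e₁ e' → r e₂ e' → e₁ = e₂) :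
    ∀ e' ∈ E, ∃ e ∈ E, r e e' := by
  choose σ hσE hσ using hs
  let g : E → E := fun e => ⟨σ e e.2, hσE e e.2⟩
  have hg : Function.Injective g := by
    intro e₁ e₂ h
    have h' : σ e₁ e₁.2 = σ e₂ e₂.2 := congrArg Subtype.val h
    exact Subtype.ext (hinj _ e₁.2 _ e₂.2 _ (hσE e₁ e₁.2) (hσ e₁ e₁.2) (h' ▸ hσ e₂ e₂.2))
  intro e' he'
  obtain ⟨e, he⟩ := Finite.surjective_of_injective hg ⟨e', he'⟩
  refine ⟨e, e.2, ?_⟩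
  have := hσ e e.2
  rwa [show σ e e.2 = e' from congrArg Subtype.val he] at this

variable {V : Type*} {D : Digraph V} {x : V} {Ω : V → V → Prop}

/-- A set `Ω` of missing pairs, containing all missing pairs at `x`, that is a union of connected
components of the dependency digraph in which all in- and out-degrees are positive. -/
structure IsBalanced (D : Digraph V) (x : V) (Ω : V → V → Prop) : Prop where
  star_mem : ∀ {a}, D.missingGraph.Adj x a → Ω x a
  symm : ∀ {u v}, Ω u v → Ω v u
  succ_mem : ∀ {u v u' v'}, Ω u v → D.Beats u v u' v' → Ω u' v'
  pred_mem : ∀ {u v u' v'}, Ω u' v' → D.Beats u v u' v' → Ω u v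
  exists_succ : ∀ {u v}, Ω u v → ∃ u' v', D.Beats u v u' v'
  exists_pred : ∀ {u v}, Ω u v → ∃ u' v', D.Beats u' v' u v

/-- The missing pairs reached from missing pairs at `x` along the losing relation; the first entry
is the endpoint that is dominated by the center. -/
inductive FromStar (D : Digraph V) (x : V) : V → V → Prop
  | base {a p q : V} : D.Beats x a q p → FromStar D x p q
  | step {p q p' q' : V} : FromStar D x p q → D.Beats p q q' p' → p' ≠ x → q' ≠ x →
      FromStar D x p' q'

/-- The missing pairs, disjoint from `x`, that reach missing pairs at `x` along the losing
relation. -/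
inductive ToStar (D : Digraph V) (x : V) : V → V → Prop
  | base {a p q : V} : D.Beats p q x a → q ≠ x → ToStar D x p q
  | step {p q p' q' : V} : ToStar D x p' q' → D.Beats p q q' p' → p ≠ x → q ≠ x →
      ToStar D x p q

theorem FromStar.missing {p q : V} (h : D.FromStar x p q) : D.missingGraph.Adj p q := by
  cases h with
  | base h => exact h.right.symm
  | step _ h => exact h.right.symm

theorem ToStar.missing {p q : V} (h : D.ToStar x p q) : D.missingGraph.Adj p q := by
  cases h with
  | base h => exact h.left
  | step _ h => exact h.left

theorem FromStar.ne (hD : D.IsOriented) {p q : V} (h : D.FromStar x p q) : p ≠ x ∧ q ≠ x := by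
  cases h with
  | base h =>
    refine ⟨?_, (hD.ne_of_adj h.adj₁).symm⟩
    rintro rfl
    exact h.left.2.2 h.adj₂
  | step _ _ h1 h2 => exact ⟨h1, h2⟩

theorem ToStar.ne (hD : D.IsOriented) {p q : V} (h : D.ToStar x p q) : p ≠ x ∧ q ≠ x := by
  cases h with
  | base h h' => exact ⟨hD.ne_of_adj h.adj₁, h'⟩
  | step _ _ h1 h2 => exact ⟨h1, h2⟩

/-- A vertex missing an edge away from `x` is joined to `x` by an arc. -/
theorem MissesAtMostOne.adj_or_adj (hx : D.MissesAtMostOne x) {u v : V}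
    (huv : D.missingGraph.Adj u v) (hu : u ≠ x) (hv : v ≠ x) : D.Adj u x ∨ D.Adj x u := by
  by_contra hc
  push Not at hc
  exact hv (hx hu huv (missing_of_not_adj hu hc.1 hc.2))

theorem FromStar.adj_center (hD : D.IsOriented) (hx : D.MissesAtMostOne x) {p q : V}
    (h : D.FromStar x p q) : D.Adj p x := by
  induction h with
  | base h => exact h.back' hD hx
  | step hf hb h1 h2 ih => exact hb.adj_of_adj ih (hx.adj_or_adj hb.right.symm h1 h2)

theorem ToStar.center_adj (hD : D.IsOriented) (hx : D.MissesAtMostOne x) {p q : V}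
    (h : D.ToStar x p q) : D.Adj x q := by
  induction h with
  | base h => exact h.back hD hx
  | step hf hb h1 h2 ih =>
    refine (hx.adj_or_adj hb.left.symm h2 h1).resolve_left fun hc => ?_
    exact hb.not_path₂ _ hc ih

theorem IsBalanced.mem_of_fromStar (hΩ : D.IsBalanced x Ω) {p q : V} (h : D.FromStar x p q) :
    Ω p q := by
  induction h with
  | base h => exact hΩ.symm (hΩ.succ_mem (hΩ.star_mem h.left) h)
  | step _ hb _ _ ih => exact hΩ.symm (hΩ.succ_mem ih hb)

theorem IsBalanced.mem_of_toStar (hΩ : D.IsBalanced x Ω) {p q : V} (h : D.ToStar x p q) :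
    Ω p q := by
  induction h with
  | base h => exact hΩ.pred_mem (hΩ.star_mem h.right) h
  | step _ hb _ _ ih => exact hΩ.pred_mem (hΩ.symm ih) hb

theorem MissesAtMostOne.eq_of_missing (hx : D.MissesAtMostOne x) {p q p' q' : V}
    (h : D.missingGraph.Adj p q) (h' : D.missingGraph.Adj p' q') (hp : p ≠ x) (hq : q ≠ x)
    (heq : p = p' ∨ q = q') : p = p' ∧ q = q' := by
  rcases heq with rfl | rfl
  · exact ⟨rfl, hx hp h h'⟩
  · exact ⟨hx hq h.symm h'.symm, rfl⟩

/-- A chain leaving the star must return to it. The pairs that never return would be closed under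
successors, hence by finiteness under predecessors; tracing back then stays among pairs avoiding
`x`, yet reaches a star edge. -/
theorem IsBalanced.toStar_of_fromStar [Finite V] (hD : D.IsOriented) (hx : D.MissesAtMostOne x)
    (hΩ : D.IsBalanced x Ω) {p q : V} (h : D.FromStar x p q) : D.ToStar x p q := by
  set E : Set (V × V) := {e | D.FromStar x e.1 e.2 ∧ ¬ D.ToStar x e.1 e.2} with hE
  have hpred := exists_pred_of_exists_succ (E := E)
    (r := fun e f => D.Beats e.1 e.2 f.2 f.1) ?_ ?_
  · have hnot : (p, q) ∉ E := by
      induction h with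
      | base h =>
        intro hmem
        obtain ⟨⟨p₀, q₀⟩, ⟨h₀, -⟩, hb⟩ := hpred _ hmem
        have hne := h₀.ne hD
        rcases (hx.eq_of_missing h₀.missing h.left hne.1 hne.2
          (hb.eq_or_eq_left hD hx h)).1 with rfl
        exact hne.1 rfl
      | step hf hb h1 h2 ih =>
        intro hmem
        obtain ⟨⟨p₀, q₀⟩, h₀, hb'⟩ := hpred _ hmem
        have hne := h₀.1.ne hD
        obtain ⟨rfl, rfl⟩ := hx.eq_of_missing h₀.1.missing hb.left hne.1 hne.2
          (hb'.eq_or_eq_left hD hx hb)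
        exact ih h₀
    by_contra hc
    exact hnot ⟨h, hc⟩
  · rintro ⟨p, q⟩ ⟨hf, ht⟩
    have hne := hf.ne hD
    obtain ⟨u, v, hb⟩ := hΩ.exists_succ (hΩ.mem_of_fromStar hf)
    have hu : u ≠ x := by
      rintro rfl
      exact ht (.base hb hne.2)
    have hv : v ≠ x := by
      rintro rfl
      exact hD (hf.adj_center hD hx) (hb.back' hD hx)
    exact ⟨(v, u), ⟨hf.step hb hv hu, fun h => ht (h.step hb hne.1 hne.2)⟩, hb⟩
  · rintro ⟨p, q⟩ hp ⟨p', q'⟩ - e' - hb hb'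
    have hne := hp.1.ne hD
    obtain ⟨rfl, rfl⟩ := hx.eq_of_missing hb.left hb'.left hne.1 hne.2
      (hb.eq_or_eq_left hD hx hb')
    rfl

theorem IsBalanced.fromStar_of_toStar [Finite V] (hD : D.IsOriented) (hx : D.MissesAtMostOne x)
    (hΩ : D.IsBalanced x Ω) {p q : V} (h : D.ToStar x p q) : D.FromStar x p q := by
  set E : Set (V × V) := {e | D.ToStar x e.1 e.2 ∧ ¬ D.FromStar x e.1 e.2} with hE
  have hsucc := exists_pred_of_exists_succ (E := E)
    (r := fun e f => D.Beats f.1 f.2 e.2 e.1) ?_ ?_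
  · have hnot : (p, q) ∉ E := by
      induction h with
      | base h h1 =>
        intro hmem
        obtain ⟨⟨p₀, q₀⟩, ⟨h₀, -⟩, hb⟩ := hsucc _ hmem
        have hne := h₀.ne hD
        exact hne.2 (hx.eq_of_missing h₀.missing h.right.symm hne.1 hne.2
          (hb.eq_or_eq_right hD hx h)).2
      | step hf hb h1 h2 ih =>
        intro hmem
        obtain ⟨⟨p₀, q₀⟩, h₀, hb'⟩ := hsucc _ hmem
        have hne := h₀.1.ne hD
        obtain ⟨rfl, rfl⟩ := hx.eq_of_missing h₀.1.missing hb.right.symm hne.1 hne.2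
          (hb'.eq_or_eq_right hD hx hb)
        exact ih h₀
    by_contra hc
    exact hnot ⟨h, hc⟩
  · rintro ⟨p, q⟩ ⟨ht, hf⟩
    have hne := ht.ne hD
    obtain ⟨u, v, hb⟩ := hΩ.exists_pred (hΩ.symm (hΩ.mem_of_toStar ht))
    have hu : u ≠ x := by
      rintro rfl
      exact hf (.base hb)
    have hv : v ≠ x := by
      rintro rfl
      exact hD (ht.center_adj hD hx) (hb.back hD hx)
    exact ⟨(u, v), ⟨ht.step hb hu hv, fun h => hf (h.step hb hne.1 hne.2)⟩, hb⟩
  · rintro ⟨p, q⟩ hp ⟨p', q'⟩ - e' - hb hb'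
    have hne := hp.1.ne hD
    obtain ⟨rfl, rfl⟩ := hx.eq_of_missing hb.right.symm hb'.right.symm hne.1 hne.2
      (hb.eq_or_eq_right hD hx hb')
    rfl

/-- A set of vertices all of whose members have the same out-neighbors and the same in-neighbors
outside it, every outside vertex being adjacent to them. -/
def IsModule (D : Digraph V) (K : Set V) : Prop :=
  ∀ v ∉ K, (∀ u ∈ K, D.Adj u v) ∨ ∀ u ∈ K, D.Adj v u

/-- An arc from `x` to an outside vertex propagates forwards along the losing relation, and an arc
into `x` backwards. Since chains run from the star back to the star, both directions reach all of
`K`. Every pair on a chain satisfies p → x → q, so the out-neighbors of `x` in `K` are the second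
entries; each is matched with a second out-neighbor one step away on its chain. -/
theorem IsBalanced.exists_isModule [Finite V] (hD : D.IsOriented) (hx : D.MissesAtMostOne x)
    (hΩ : D.IsBalanced x Ω) :
    ∃ K : Set V, D.IsModule K ∧ x ∈ K ∧ (∀ a, D.missingGraph.Adj x a → a ∈ K) ∧
      (D.outNbhd x ∩ K).ncard ≤ {w ∈ K | w ≠ x ∧ ¬ D.Adj x w ∧ ∃ u ∈ K, D.Adj x u ∧ D.Adj u w}.ncard
      := by
  set K : Set V := {u | u = x ∨ D.missingGraph.Adj x u ∨
    (∃ w, D.FromStar x u w) ∨ ∃ w, D.FromStar x w u} with hK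
  have hstar : ∀ {a}, D.missingGraph.Adj x a → a ∈ K := fun h => .inr (.inl h)
  have hleft : ∀ {p q}, D.FromStar x p q → p ∈ K := fun h => .inr (.inr (.inl ⟨_, h⟩))
  have hright : ∀ {p q}, D.FromStar x p q → q ∈ K := fun h => .inr (.inr (.inr ⟨_, h⟩))
  have hto : ∀ {p q}, D.FromStar x p q → D.ToStar x p q := hΩ.toStar_of_fromStar hD hx
  have hfrom : ∀ {p q}, D.ToStar x p q → D.FromStar x p q := hΩ.fromStar_of_toStar hD hx
  have hleaf : ∀ {a}, D.missingGraph.Adj x a → a ≠ x := fun h => h.ne.symm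
  -- every leaf is followed and preceded by pairs of `FromStar`
  have hleafsucc : ∀ {a}, D.missingGraph.Adj x a → ∃ p q, D.Beats x a q p ∧ D.FromStar x p q := by
    intro a ha
    obtain ⟨q, p, hb⟩ := hΩ.exists_succ (hΩ.star_mem ha)
    exact ⟨p, q, hb, .base hb⟩
  have hleafpred : ∀ {a}, D.missingGraph.Adj x a → ∃ p q, D.Beats p q x a ∧ D.FromStar x p q := by
    intro a ha
    obtain ⟨p, q, hb⟩ := hΩ.exists_pred (hΩ.star_mem ha)
    have hq : q ≠ x := by
      rintro rfl
      exact ha.2.1 hb.adj₂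
    exact ⟨p, q, hb, hfrom (.base hb hq)⟩
  have hadj : ∀ u ∈ K, ∀ v ∉ K, D.Adj u v ∨ D.Adj v u := by
    intro u hu v hv
    by_contra hc
    push Not at hc
    have hm : D.missingGraph.Adj u v := missing_of_not_adj (by rintro rfl; exact hv hu) hc.1 hc.2
    rcases hu with rfl | hu | ⟨w, hw⟩ | ⟨w, hw⟩
    · exact hv (hstar hm)
    · exact hv (.inl (hx (hleaf hu) hm hu.symm))
    · exact hv (hx (hw.ne hD).1 hm hw.missing ▸ hright hw)
    · exact hv (hx (hw.ne hD).2 hm hw.missing.symm ▸ hleft hw)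
  have hmod : D.IsModule K := by
    intro v hv
    rcases hadj x (.inl rfl) v hv with hxv | hvx
    · left
      have hp : ∀ p q, D.FromStar x p q → D.Adj p v := by
        intro p q h
        induction h with
        | base h => exact h.adj_of_adj hxv (hadj _ (hleft (.base h)) v hv)
        | step hf hb h1 h2 ih => exact hb.adj_of_adj ih (hadj _ (hleft (hf.step hb h1 h2)) v hv)
      have ha : ∀ a, D.missingGraph.Adj x a → D.Adj a v := by
        intro a ha
        obtain ⟨p, q, hb, hf⟩ := hleafpred ha
        exact hb.adj_of_adj (hp p q hf) (hadj a (hstar ha) v hv)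
      have hq : ∀ p q, D.FromStar x p q → D.Adj q v := by
        intro p q h
        induction h with
        | base h => exact h.swap.adj_of_adj (ha _ h.left) (hadj _ (hright (.base h)) v hv)
        | step hf hb h1 h2 ih =>
          exact hb.swap.adj_of_adj ih (hadj _ (hright (hf.step hb h1 h2)) v hv)
      rintro u (rfl | hu | ⟨w, hw⟩ | ⟨w, hw⟩)
      exacts [hxv, ha u hu, hp u w hw, hq w u hw]
    · right
      have hback : ∀ {a b a' b'}, D.Beats a b a' b' → a ∈ K → D.Adj v b' → D.Adj v a :=
        fun hb ha hvb => (hadj _ ha v hv).resolve_left fun hc => hb.not_path₁ _ hc hvb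
      have hq : ∀ p q, D.ToStar x p q → D.Adj v q := by
        intro p q h
        induction h with
        | base h h' => exact hback h.swap (hright (hfrom (.base h h'))) hvx
        | step ht hb h1 h2 ih => exact hback hb.swap (hright (hfrom (ht.step hb h1 h2))) ih
      have ha : ∀ a, D.missingGraph.Adj x a → D.Adj v a := by
        intro a ha
        obtain ⟨p, q, hb, hf⟩ := hleafsucc ha
        exact hback hb.swap (hstar ha) (hq p q (hto hf))
      have hp : ∀ p q, D.ToStar x p q → D.Adj v p := by
        intro p q h
        induction h with
        | base h h' => exact hback h (hleft (hfrom (.base h h'))) (ha _ h.right)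
        | step ht hb h1 h2 ih => exact hback hb (hleft (hfrom (ht.step hb h1 h2))) ih
      rintro u (rfl | hu | ⟨w, hw⟩ | ⟨w, hw⟩)
      exacts [hvx, ha u hu, hp u w (hto hw), hq w u (hto hw)]
  refine ⟨K, hmod, .inl rfl, fun a ha => hstar ha, ?_⟩
  -- an out-neighbor of `x` in `K` is sent to a leaf preceding it, or to its missing partner
  have hout : ∀ q ∈ D.outNbhd x ∩ K, ∃ p, D.FromStar x p q := by
    rintro q ⟨hxq, rfl | hq | ⟨w, hw⟩ | h⟩
    · exact absurd hxq fun h => hD h h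
    · exact absurd hxq hq.2.1
    · exact absurd hxq (hD (hw.adj_center hD hx))
    · exact h
  have himage : ∀ q ∈ D.outNbhd x ∩ K,
      ∃ y ∈ {w ∈ K | w ≠ x ∧ ¬ D.Adj x w ∧ ∃ u ∈ K, D.Adj x u ∧ D.Adj u w},
        (∃ p, D.Beats x y q p) ∨ (D.FromStar x y q) := by
    intro q hq
    obtain ⟨p, hpq⟩ := hout q hq
    have hnp := hD (hpq.adj_center hD hx)
    cases id hpq with
    | base h =>
      rename_i a
      exact ⟨a, ⟨hstar h.left, hleaf h.left, h.left.2.1, q, hright hpq, h.adj₁, h.back hD hx⟩,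
        .inl ⟨p, h⟩⟩
    | step hf hb h1 h2 =>
      rename_i p' q'
      exact ⟨p, ⟨hleft hpq, h1, hnp, q', hright hf, (hto hf).center_adj hD hx, hb.adj₂⟩, .inr hpq⟩
  choose! φ hφ hφ' using himage
  refine Set.ncard_le_ncard_of_injOn φ hφ ?_ (Set.toFinite _)
  intro q₁ h₁ q₂ h₂ heq
  have e₁ := hφ' q₁ h₁
  have e₂ := hφ' q₂ h₂
  rw [← heq] at e₂
  -- Leaves and first entries of chain pairs cannot coincide, so the two kinds of image are
  -- disjoint.
  have hno : ∀ {y p q q'}, D.Beats x y q p → D.FromStar x y q' → False := by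
    intro y p q q' hb hf
    exact (hf.ne hD).2 (hx (hf.ne hD).1 hf.missing hb.left.symm)
  rcases e₁ with ⟨p, hb⟩ | hf <;> rcases e₂ with ⟨p', hb'⟩ | hf'
  · have hne := (FromStar.base hb).ne hD
    exact (hx.eq_of_missing hb.right.symm hb'.right.symm hne.1 hne.2
      (hb.eq_or_eq_right hD hx hb')).2
  · exact (hno hb hf').elim
  · exact (hno hb' hf).elim
  · exact hx (hf.ne hD).1 hf.missing hf'.missing

end Balanced

end Digraph

namespace Digraph

/-! ### Collapsing modules to transitive tournaments. -/

section Reduction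

variable {V : Type*} {D : Digraph V} {K : Set V} {ℓ : V → ℕ}

/-- The digraph obtained from `D` by replacing the arcs inside `K` by a transitive tournament. -/
def transitiveOn (D : Digraph V) (K : Set V) (ℓ : V → ℕ) : Digraph V where
  Adj u v := (u ∈ K ∧ v ∈ K ∧ ℓ u < ℓ v) ∨ (¬ (u ∈ K ∧ v ∈ K) ∧ D.Adj u v)

theorem transitiveOn_adj_iff {u v : V} (h : u ∉ K ∨ v ∉ K) :
    (D.transitiveOn K ℓ).Adj u v ↔ D.Adj u v := by
  simp only [transitiveOn]
  tauto

theorem transitiveOn_adj_iff_of_mem {u v : V} (hu : u ∈ K) (hv : v ∈ K) :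
    (D.transitiveOn K ℓ).Adj u v ↔ ℓ u < ℓ v := by
  simp only [transitiveOn]
  tauto

theorem IsOriented.transitiveOn (hD : D.IsOriented) : (D.transitiveOn K ℓ).IsOriented := by
  intro u v h h'
  by_cases hK : u ∈ K ∧ v ∈ K
  · rw [transitiveOn_adj_iff_of_mem hK.1 hK.2] at h
    rw [transitiveOn_adj_iff_of_mem hK.2 hK.1] at h'
    omega
  · rw [transitiveOn_adj_iff (by tauto)] at h h'
    exact hD h h'

theorem missing_of_transitiveOn (hℓ : Function.Injective ℓ) {u v : V}
    (h : (D.transitiveOn K ℓ).missingGraph.Adj u v) :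
    D.missingGraph.Adj u v ∧ ¬ (u ∈ K ∧ v ∈ K) := by
  obtain ⟨hne, h1, h2⟩ := h
  by_cases hK : u ∈ K ∧ v ∈ K
  · rw [transitiveOn_adj_iff_of_mem hK.1 hK.2] at h1
    rw [transitiveOn_adj_iff_of_mem hK.2 hK.1] at h2
    exact absurd (hℓ (by omega)) hne
  · rw [transitiveOn_adj_iff (by tauto)] at h1 h2
    exact ⟨⟨hne, h1, h2⟩, hK⟩

/-- A module with a vertex that has enough second out-neighbors inside the module may be replaced
by a transitive tournament. -/
theorem IsModule.exists_le_of_transitiveOn [Finite V] (hD : D.IsOriented) (hK : D.IsModule K)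
    {x : V} (hx : x ∈ K)
    (hin : (D.outNbhd x ∩ K).ncard ≤
      {w ∈ K | w ≠ x ∧ ¬ D.Adj x w ∧ ∃ u ∈ K, D.Adj x u ∧ D.Adj u w}.ncard)
    (h : ∃ v, (D.transitiveOn K ℓ).outDeg v ≤ (D.transitiveOn K ℓ).secondOutDeg v) :
    ∃ v, D.outDeg v ≤ D.secondOutDeg v := by
  obtain ⟨f, hf⟩ := h
  unfold outDeg secondOutDeg at hf ⊢
  by_cases hfK : f ∈ K
  · refine ⟨x, ?_⟩
    have hmod : ∀ {u u' v}, u ∈ K → u' ∈ K → v ∉ K → D.Adj u v → D.Adj u' v := by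
      intro u u' v hu hu' hv h
      rcases hK v hv with h' | h'
      · exact h' u' hu'
      · exact absurd (h' u hu) (hD h)
    have hmod' : ∀ {u u' v}, u ∈ K → u' ∈ K → v ∉ K → D.Adj v u → ¬ D.Adj u' v := by
      intro u u' v hu hu' hv h h'
      exact hD h (hmod hu' hu hv h')
    have h1 : D.outNbhd x \ K ⊆ (D.transitiveOn K ℓ).outNbhd f := fun v hv =>
      (transitiveOn_adj_iff (.inr hv.2)).2 (hmod hx hfK hv.2 hv.1)
    -- By transitivity a path of length two inside `K` gives no second out-neighbor, and a module
    -- cannot be left and re-entered through one vertex. Outside `K`, `f` and `x` see the same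
    -- vertices.
    have h2 : (D.transitiveOn K ℓ).secondOutNbhd f ⊆ D.secondOutNbhd x \ K := by
      rintro w ⟨hwf, hfw, u, hfu, huw⟩
      have hwK : w ∉ K := by
        intro hwK
        by_cases huK : u ∈ K
        · rw [transitiveOn_adj_iff_of_mem hfK huK] at hfu
          rw [transitiveOn_adj_iff_of_mem huK hwK] at huw
          exact hfw ((transitiveOn_adj_iff_of_mem hfK hwK).2 (hfu.trans huw))
        · rw [transitiveOn_adj_iff (.inr huK)] at hfu
          rw [transitiveOn_adj_iff (.inl huK)] at huw
          exact hmod' hwK hfK huK huw hfu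
      rw [transitiveOn_adj_iff (.inr hwK)] at hfw huw
      have huK : u ∉ K := fun huK => hfw (hmod huK hfK hwK huw)
      rw [transitiveOn_adj_iff (.inr huK)] at hfu
      refine ⟨⟨?_, fun h => hfw (hmod hx hfK hwK h), u, hmod hfK hx huK hfu, huw⟩, hwK⟩
      rintro rfl
      exact hwK hx
    have h3 : {w ∈ K | w ≠ x ∧ ¬ D.Adj x w ∧ ∃ u ∈ K, D.Adj x u ∧ D.Adj u w} ⊆
        D.secondOutNbhd x ∩ K := by
      rintro w ⟨hwK, hwx, hxw, u, -, hu⟩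
      exact ⟨⟨hwx, hxw, u, hu⟩, hwK⟩
    rw [← Set.ncard_inter_add_ncard_sdiff_eq_ncard (D.outNbhd x) K (Set.toFinite _),
      ← Set.ncard_inter_add_ncard_sdiff_eq_ncard (D.secondOutNbhd x) K (Set.toFinite _)]
    exact add_le_add (hin.trans (Set.ncard_le_ncard h3 (Set.toFinite _)))
      (((Set.ncard_le_ncard h1 (Set.toFinite _)).trans hf).trans
        (Set.ncard_le_ncard h2 (Set.toFinite _)))
  · refine ⟨f, ?_⟩
    have h1 : (D.transitiveOn K ℓ).outNbhd f = D.outNbhd f :=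
      Set.ext fun v => transitiveOn_adj_iff (.inl hfK)
    have h2 : (D.transitiveOn K ℓ).secondOutNbhd f ⊆ D.secondOutNbhd f := by
      rintro w ⟨hwf, hfw, u, hfu, huw⟩
      rw [transitiveOn_adj_iff (.inl hfK)] at hfw hfu
      refine ⟨hwf, hfw, u, hfu, ?_⟩
      by_cases hc : u ∈ K ∧ w ∈ K
      · rcases hK f hfK with h' | h'
        · exact absurd (h' u hc.1) (hD hfu)
        · exact absurd (h' w hc.2) hfw
      · exact (transitiveOn_adj_iff (by tauto)).1 huw
    rw [h1] at hf
    exact hf.trans (Set.ncard_le_ncard h2 (Set.toFinite _))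

/-- Inaccessible pairs are those on cycles: each has an inaccessible predecessor, and uniqueness on
both sides with finiteness gives successors as well. The star is the single edge `x a`. -/
theorem isBalanced_not_acc [Finite V] (hD : D.IsOriented) (hM : ∀ x, D.MissesAtMostOne x)
    {x a : V} (hxa : D.missingGraph.Adj x a)
    (hacc : ¬ Acc (fun p q : V × V => D.Beats p.1 p.2 q.1 q.2) (x, a)) :
    D.IsBalanced x fun u v => D.missingGraph.Adj u v ∧
      ¬ Acc (fun p q : V × V => D.Beats p.1 p.2 q.1 q.2) (u, v) := by
  have hswap : ∀ p : V × V, Acc (fun p q : V × V => D.Beats p.1 p.2 q.1 q.2) p →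
      Acc (fun p q : V × V => D.Beats p.1 p.2 q.1 q.2) p.swap := by
    intro p hp
    induction hp with
    | intro p _ ih => exact Acc.intro _ fun q hq => by simpa using ih q.swap hq.swap
  have hpred : ∀ p : V × V, ¬ Acc (fun p q : V × V => D.Beats p.1 p.2 q.1 q.2) p →
      ∃ q : V × V, D.Beats q.1 q.2 p.1 p.2 ∧
        ¬ Acc (fun p q : V × V => D.Beats p.1 p.2 q.1 q.2) q := by
    intro p hp
    by_contra hc
    push Not at hc
    exact hp (Acc.intro _ hc)
  have hsucc := exists_pred_of_exists_succ
    (E := {p : V × V | ¬ Acc (fun p q : V × V => D.Beats p.1 p.2 q.1 q.2) p})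
    (r := fun p q => D.Beats q.1 q.2 p.1 p.2)
    (fun p hp => (hpred p hp).imp fun q hq => ⟨hq.2, hq.1⟩)
    (fun p _ q _ e _ (hp : D.Beats e.1 e.2 p.1 p.2) (hq : D.Beats e.1 e.2 q.1 q.2) =>
      Prod.ext_iff.2 (hp.eq_right hD hM hq))
  refine ⟨?_, ?_, ?_, ?_, ?_, ?_⟩
  · intro b hb
    obtain rfl := hM a hxa.ne hxa hb
    exact ⟨hxa, hacc⟩
  · rintro u v ⟨h1, h2⟩
    exact ⟨h1.symm, fun h => h2 (hswap _ h)⟩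
  · rintro u v u' v' ⟨h1, h2⟩ hb
    exact ⟨hb.right, fun h => h2 (h.inv hb)⟩
  · rintro u v u' v' ⟨h1, h2⟩ hb
    refine ⟨hb.left, ?_⟩
    obtain ⟨q, hq, hq'⟩ := hpred _ h2
    obtain ⟨rfl, rfl⟩ := hb.eq_left hD hM hq
    exact hq'
  · rintro u v ⟨h1, h2⟩
    obtain ⟨q, -, hq⟩ := hsucc _ h2
    exact ⟨_, _, hq⟩
  · rintro u v ⟨h1, h2⟩
    obtain ⟨q, hq, -⟩ := hpred _ h2
    exact ⟨_, _, hq⟩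

/-- The second neighborhood conjecture for digraphs missing a matching. -/
theorem exists_le_of_missing_matching [Finite V] [Nonempty V] (hD : D.IsOriented)
    (hM : ∀ x, D.MissesAtMostOne x) : ∃ v, D.outDeg v ≤ D.secondOutDeg v := by
  obtain ⟨ℓ, hℓ⟩ := exists_injective_nat V
  -- Each collapse fills the missing pair `x a` inside `K` and creates no new missing pair.
  induction hn : {p : V × V | D.missingGraph.Adj p.1 p.2}.ncard using Nat.strong_induction_on
    generalizing D with
  | _ n ih =>
  by_cases hacc : ∀ a b, D.missingGraph.Adj a b →
      Acc (fun p q : V × V => D.Beats p.1 p.2 q.1 q.2) (a, b)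
  · exact exists_le_of_acc hD hM hacc
  push Not at hacc
  obtain ⟨x, a, hxa, hacc⟩ := hacc
  obtain ⟨K, hK, hxK, hstar, hin⟩ :=
    (isBalanced_not_acc hD hM hxa hacc).exists_isModule hD (hM x)
  refine hK.exists_le_of_transitiveOn (ℓ := ℓ) hD hxK hin (ih _ ?_ hD.transitiveOn ?_ rfl)
  · rw [← hn]
    refine Set.ncard_lt_ncard (Set.ssubset_iff_exists.2 ⟨?_, (x, a), hxa, ?_⟩) (Set.toFinite _)
    · exact fun p hp => (missing_of_transitiveOn hℓ hp).1
    · exact fun hp => (missing_of_transitiveOn hℓ hp).2 ⟨hxK, hstar a hxa⟩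
  · exact fun y u v w hu huv huw => hM y hu (missing_of_transitiveOn hℓ huv).1
      (missing_of_transitiveOn hℓ huw).1

/-- The second neighborhood conjecture for digraphs missing a star and a matching, when all
dependency components of star edges have positive in- and out-degrees. -/
theorem IsBalanced.exists_le [Finite V] [Nonempty V] {x : V} {Ω : V → V → Prop}
    (hΩ : D.IsBalanced x Ω) (hD : D.IsOriented) (hx : D.MissesAtMostOne x) :
    ∃ v, D.outDeg v ≤ D.secondOutDeg v := by
  obtain ⟨ℓ, hℓ⟩ := exists_injective_nat V
  obtain ⟨K, hK, hxK, hstar, hin⟩ := hΩ.exists_isModule hD hx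
  refine hK.exists_le_of_transitiveOn (ℓ := ℓ) hD hxK hin
    (exists_le_of_missing_matching hD.transitiveOn ?_)
  intro y u v w _ huv huw
  obtain ⟨huv, hK'⟩ := missing_of_transitiveOn hℓ huv
  -- After the collapse no missing edge meets `x`, so a matching is left.
  refine hx ?_ huv (missing_of_transitiveOn hℓ huw).1
  rintro rfl
  exact hK' ⟨hxK, hstar v huv⟩

end Reduction

/-! ### Components of the dependency digraph. -/

section Components

variable {V : Type*} {D : Digraph V}

theorem IsOriented.component_eq_of_losesTo {e f : D.missingGraph.edgeSet}
    (hD : D.IsOriented) (h : D.dependency.Adj e f) :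
    D.dependency.toSimpleGraphInclusive.connectedComponentMk e =
      D.dependency.toSimpleGraphInclusive.connectedComponentMk f := by
  have hne : e ≠ f := by
    rintro rfl
    obtain ⟨e, he⟩ := e
    induction e using Sym2.inductionOn with
    | _ u v =>
    obtain ⟨u', v', he', hb⟩ := (losesTo_iff _ he he).1 h
    rcases Sym2.eq_iff.1 he' with ⟨rfl, rfl⟩ | ⟨rfl, rfl⟩
    · exact hD hb.adj₁ hb.adj₁
    · exact he.2.1 hb.adj₁
  refine SimpleGraph.ConnectedComponent.sound (SimpleGraph.Adj.reachable ?_)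
  simp [toSimpleGraphInclusive, hne, h]

theorem exists_adj_of_pos_minOutDeg [Finite V] (h : 0 < D.minOutDeg) (v : V) : ∃ w, D.Adj v w := by
  have h1 : 0 < D.outDeg v := h.trans_le (ciInf_le (OrderBot.bddBelow _) v)
  exact (Set.ncard_pos (Set.toFinite _)).1 h1

theorem exists_adj_of_pos_minInDeg [Finite V] (h : 0 < D.minInDeg) (v : V) : ∃ w, D.Adj w v := by
  have h1 : 0 < D.inDeg v := h.trans_le (ciInf_le (OrderBot.bddBelow _) v)
  exact (Set.ncard_pos (Set.toFinite _)).1 h1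

end Components

end Digraph

/-! ### The main theorem. -/

theorem theorem3 {V : Type*} [Finite V] [Nonempty V] (D : Digraph V) (hD : D.IsOriented)
    (S M : SimpleGraph V) (hS : S.IsStarGraph) (hM : M.IsMatchingGraph)
    (hdisj : Disjoint S.support M.support) (hmiss : D.missingGraph = S ⊔ M)
    (hcomp : ∀ C : D.dependency.Component,
      (∃ e ∈ C.supp, (e : Sym2 V) ∈ S.edgeSet) →
        0 < (D.dependency.restrict C.supp).minOutDeg ∧
        0 < (D.dependency.restrict C.supp).minInDeg) :
    ∃ v : V, D.outDeg v ≤ D.secondOutDeg v := by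
  obtain ⟨x, hx⟩ := hS
  have hadj : ∀ {u v}, D.missingGraph.Adj u v ↔ S.Adj u v ∨ M.Adj u v := by simp [hmiss]
  have hSM : ∀ {u v w}, S.Adj u v → ¬ M.Adj u w := fun h h' =>
    Set.disjoint_left.1 hdisj ⟨_, h⟩ ⟨_, h'⟩
  have hone : D.MissesAtMostOne x := by
    intro u v w hu huv huw
    rcases hadj.1 huv with huv | huv <;> rcases hadj.1 huw with huw | huw
    · rw [(hx huv).resolve_left hu, (hx huw).resolve_left hu]
    · exact absurd huw (hSM huv)
    · exact absurd huv (hSM huw)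
    · exact hM huv huw
  -- If no star edge contains the center, the star has no edges and the missing graph is a matching.
  by_cases hempty : ∀ a, ¬ S.Adj x a
  · refine Digraph.exists_le_of_missing_matching hD fun y u v w _ huv huw => ?_
    have hSe : ∀ {u v}, ¬ S.Adj u v := by
      intro u v h
      rcases hx h with rfl | rfl
      · exact hempty _ h
      · exact hempty _ h.symm
    exact hM ((hadj.1 huv).resolve_left hSe) ((hadj.1 huw).resolve_left hSe)
  push Not at hempty
  obtain ⟨b, hb⟩ := hempty
  have hstar : ∀ {a}, D.missingGraph.Adj x a → S.Adj x a := fun h =>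
    (hadj.1 h).resolve_right (hSM hb)
  let comp (e : D.missingGraph.edgeSet) : D.dependency.Component :=
    D.dependency.toSimpleGraphInclusive.connectedComponentMk e
  -- All missing pairs whose component contains some star edge: the union of the components to which
  -- the degree hypothesis applies.
  let Ω : V → V → Prop := fun u v => ∃ h : D.missingGraph.Adj u v,
    ∃ e ∈ (comp ⟨s(u, v), h⟩).supp, (e : Sym2 V) ∈ S.edgeSet
  have hbeats : ∀ {u v u' v'} (h : D.Beats u v u' v'),
      comp ⟨s(u, v), h.left⟩ = comp ⟨s(u', v'), h.right⟩ := fun h =>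
    hD.component_eq_of_losesTo ((Digraph.losesTo_iff _ h.left h.right).2 ⟨_, _, rfl, h⟩)
  have hΩ : D.IsBalanced x Ω := by
    refine ⟨?_, ?_, ?_, ?_, ?_, ?_⟩
    · exact fun h => ⟨h, ⟨_, h⟩, rfl, hstar h⟩
    · rintro u v ⟨h, e, he⟩
      refine ⟨h.symm, e, ?_⟩
      have : (⟨s(v, u), h.symm⟩ : D.missingGraph.edgeSet) = ⟨s(u, v), h⟩ :=
        Subtype.ext Sym2.eq_swap
      rwa [this]
    · rintro u v u' v' ⟨h, he⟩ hb
      exact ⟨hb.right, hbeats hb ▸ he⟩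
    · rintro u v u' v' ⟨h, he⟩ hb
      exact ⟨hb.left, (hbeats hb).symm ▸ he⟩
    · rintro u v ⟨h, he⟩
      obtain ⟨⟨⟨f, hf⟩, _⟩, hadj⟩ :=
        Digraph.exists_adj_of_pos_minOutDeg (hcomp _ he).1 ⟨⟨s(u, v), h⟩, rfl⟩
      obtain ⟨u', v', -, hb⟩ := (Digraph.losesTo_iff f h hf).1 hadj
      exact ⟨u', v', hb⟩
    · rintro u v ⟨h, he⟩
      obtain ⟨⟨⟨f, hf⟩, _⟩, hadj⟩ :=
        Digraph.exists_adj_of_pos_minInDeg (hcomp _ he).2 ⟨⟨s(u, v), h⟩, rfl⟩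
      induction f using Sym2.inductionOn with
      | _ u' v' =>
      obtain ⟨u'', v'', heq, hb⟩ := (Digraph.losesTo_iff _ hf h).1 hadj
      rcases Sym2.eq_iff.1 heq with ⟨rfl, rfl⟩ | ⟨rfl, rfl⟩
      · exact ⟨u', v', hb⟩
      · exact ⟨v', u', hb.swap⟩
  exact hΩ.exists_le hD hone
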